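/- Let $p\ge 0$ and $q\ge 1$ be integers, and let $y_1,\dots,y_q$ and $w_1,\dots,w_q$ be the nodes and weights of the $q$-point Gauss--Legendre rule on $[-1,1]$. For integers $n\ge 0$ and $|m|\le n$ let $$Y_n^m(\theta,\phi)=\sqrt{\frac{2n+1}{4\pi}\,\frac{(n-|m|)!}{(n+|m|)!}}\;P_n^{|m|}(\cos\theta)\,e^{im\phi},$$ where $P_n^{|m|}$ is the associated Legendre function, and for $0\ne x\in\mathbb R^3$ with polar angle $\theta_x$ and azimuthal angle $\phi_x$ put $\tilde Y_n^m(x)=Y_n^m(\theta_x,\phi_x)$. For $h>0$ let $\Gamma_h=[0,h]^2\times\{0\}\subset\mathbb R^3$, and let $\Psi_h:[-1,1]^2\to\Gamma_h$ be given by $\Psi_h(x_1,x_2)=\frac h2(x_1+1,\,x_2+1,\,0)$, with area element $|\partial_1\Psi_h\times\partial_2\Psi_h|$. Then there is a constant $C_{p,q}>0$, depending only on $p$ and $q$, such that for all $h>0$ and $r>0$, every center $c\in\mathbb R^3$ at Euclidean distance $r$ from $\Gamma_h$, all integers $0\le n\le p$ and $|m|\le n$, and every (complex-valued) density $\mu\in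 C^{2q}(\Gamma_h)$, $$\left|\sum_{j_1=1}^q\sum_{j_2=1}^q w_{j_1}w_{j_2}\,\frac{\mu(\Psi_h(y_{j_1},y_{j_2}))}{\|\Psi_h(y_{j_1},y_{j_2})-c\|^{n+1}}\,\tilde Y_n^{-m}(\Psi_h(y_{j_1},y_{j_2})-c)\,|\partial_1\Psi_h\times\partial_2\Psi_h|(y_{j_1},y_{j_2})-\int_{\Gamma_h}\frac{\mu(s)}{\|s-c\|^{n+1}}\,\tilde Y_n^{-m}(s-c)\,dS(s)\right|$$ $$\le\; C_{p,q}\,(1+h)\left(\frac h4\right)^{2q+1}\frac1{r^{n+1}}\left[1+\left(\frac1r\right)^{2q}\right]\|\mu\|_{C^{2q}},$$ where $\|\mu\|_{C^{2q}}$ is the maximum over $\Gamma_h$ of the absolute values of all partial derivatives of $\mu$ of order at most $2q$ in the two coordinates of the square. -/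

import Mathlib

open MeasureTheory Set

noncomputable section

namespace QBX

/-- Three-dimensional Euclidean space. -/
abbrev E3 : Type := EuclideanSpace ℝ (Fin 3)

/-! ### Spherical harmonics -/

/-- The Legendre polynomial `P_n` (Rodrigues' formula). -/
def legendreP (n : ℕ) : Polynomial ℝ :=
  Polynomial.C (1 / ((2 : ℝ) ^ n * (n.factorial : ℝ))) *
    (Polynomial.derivative^[n]) ((Polynomial.X ^ 2 - 1) ^ n)

/-- The associated Legendre function `P_n^m` of degree `n` and order `m ≥ 0` on `[-1, 1]`,
`P_n^m(x) = (-1)^m (1 - x^2)^{m/2} (d/dx)^m P_n(x)`. -/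
def assocLegendre (n m : ℕ) (x : ℝ) : ℝ :=
  (-1) ^ m * Real.sqrt (1 - x ^ 2) ^ m *
    ((Polynomial.derivative^[m]) (legendreP n)).eval x

/-- The spherical harmonic `Y_n^m(θ, φ)` (`θ` polar, `φ` azimuthal). It is used for `|m| ≤ n`. -/
def sphericalHarmonic (n : ℕ) (m : ℤ) (θ φ : ℝ) : ℂ :=
  ((Real.sqrt ((2 * (n : ℝ) + 1) / (4 * Real.pi) *
        (((n - m.natAbs).factorial : ℝ) / ((n + m.natAbs).factorial : ℝ))) *
      assocLegendre n m.natAbs (Real.cos θ) : ℝ) : ℂ) *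
    Complex.exp (Complex.I * (m : ℂ) * (φ : ℂ))

/-- Polar coordinate `θ = arccos (z / ‖x‖)`. -/
def polarAngle (x : E3) : ℝ := Real.arccos (x 2 / ‖x‖)

/-- Azimuthal coordinate `φ = atan2 (y, x)`. -/
def azimuthAngle (x : E3) : ℝ := Complex.arg ⟨x 0, x 1⟩

/-- `Y_n^m` evaluated at the direction of the vector `x`. -/
def sphericalHarmonicAt (n : ℕ) (m : ℤ) (x : E3) : ℂ :=
  sphericalHarmonic n m (polarAngle x) (azimuthAngle x)

/-- The integrand `μ(s) ‖s - c‖^{-(n+1)} Y_n^{-m}(θ_{s-c}, φ_{s-c})` of the local coefficient of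
degree `n` and order `m` at the center `c`. -/
def coeffIntegrand (μ : E3 → ℂ) (c : E3) (n : ℕ) (m : ℤ) (s : E3) : ℂ :=
  μ s / ((‖s - c‖ ^ (n + 1) : ℝ) : ℂ) * sphericalHarmonicAt n (-m) (s - c)

/-! ### The flat square element -/

/-- The element `[0, h]² × {0}`. -/
def element (h : ℝ) : Set E3 := {x | x 0 ∈ Icc 0 h ∧ x 1 ∈ Icc 0 h ∧ x 2 = 0}

/-- The parametrization `Ψ(x₁, x₂) = (h/2) (x₁ + 1, x₂ + 1, 0)` of the element over the
reference element `[-1, 1]²`. -/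
def elementMap (h : ℝ) (x : ℝ × ℝ) : E3 := (h / 2) • !₂[x.1 + 1, x.2 + 1, 0]

/-- The area element `|∂₁Ψ × ∂₂Ψ|` of a parametrization `Ψ`. -/
def areaElement (Ψ : ℝ × ℝ → E3) (x : ℝ × ℝ) : ℝ :=
  ‖WithLp.toLp 2 (crossProduct (fderiv ℝ Ψ x (1, 0)).ofLp (fderiv ℝ Ψ x (0, 1)).ofLp)‖

/-! ### Gauss–Legendre quadrature -/

/-- `(y, w)` are the nodes and weights (in some order) of the `q`-point Gauss–Legendre rule on
`[-1, 1]`: the nodes are the `q` distinct zeros of `P_q`, and the weight of a node is the integral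
of the Lagrange basis polynomial that belongs to it. -/
structure IsGaussLegendre (q : ℕ) (y w : Fin q → ℝ) : Prop where
  injective : Function.Injective y
  isRoot : ∀ j, (legendreP q).IsRoot (y j)
  weight : ∀ j, w j = ∫ t in (-1 : ℝ)..1, (Lagrange.basis Finset.univ y j).eval t

/-- The tensor product rule with one-dimensional nodes `y` and weights `w`, applied to the
pullback along `Ψ` of the surface integral of `F`. -/
def tensorQuadrature {q : ℕ} (y w : Fin q → ℝ) (Ψ : ℝ × ℝ → E3) (F : E3 → ℂ) : ℂ :=
  ∑ j₁, ∑ j₂, (w j₁ : ℂ) * (w j₂ : ℂ) * F (Ψ (y j₁, y j₂)) *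
    (areaElement Ψ (y j₁, y j₂) : ℂ)

/-! ### The `C^k` norm on the element -/

/-- The square `[0, h]²`. -/
def square (h : ℝ) : Set (ℝ × ℝ) := Icc 0 h ×ˢ Icc 0 h

/-- A function on the element, in its two tangential Cartesian coordinates. -/
def onSquare (μ : E3 → ℂ) (x : ℝ × ℝ) : ℂ := μ !₂[x.1, x.2, 0]

/-- `μ` restricted to the element `[0, h]² × {0}` is of class `C^k` (up to the boundary). -/
def IsCk (k : ℕ) (h : ℝ) (μ : E3 → ℂ) : Prop :=
  ContDiffOn ℝ (k : ℕ∞) (onSquare μ) (square h)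

/-- The standard basis of the plane. -/
def basisVec : Fin 2 → ℝ × ℝ := ![(1, 0), (0, 1)]

/-- The `C^k` norm of `μ` on the element `[0, h]² × {0}`: the supremum over the element of the
absolute values of all partial derivatives `∂_{i₁} ⋯ ∂_{i_j} μ` of order `j ≤ k`. -/
def ckNorm (k : ℕ) (h : ℝ) (μ : E3 → ℂ) : ℝ :=
  sSup {a : ℝ | ∃ j ≤ k, ∃ i : Fin j → Fin 2, ∃ x ∈ square h,
    a = ‖iteratedFDerivWithin ℝ j (onSquare μ) (square h) x (fun l => basisVec (i l))‖}

end QBX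

end

/-! The proof separates quadrature from kernel analysis. Quadrature: the Gauss–Legendre rule is
exact in degree below `2 * q` and has nonnegative weights and nodes in `[-1, 1]`. Subtracting a
Taylor polynomial of degree `2 * q - 1` therefore bounds the one-dimensional error by the derivative
of order `2 * q`, and applying this one variable at a time gives `norm_tensor_error_le`, where only
pure partial derivatives occur. Kernel: `multipoleKernel` is homogeneous of degree `-(n + 1)` and
smooth off the origin, so compactness of the unit sphere and scaling bound its `j`-th derivative by
a constant times `‖z‖ ^ -(n + 1 + j)` (`exists_norm_iteratedFDeriv_le_of_homogeneous`). On the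
element `‖z‖ ≥ r`, and the Leibniz rule gives `norm_iteratedDerivWithin_mul_multipoleKernel_le`, the
bound fed into the quadrature estimate. -/

namespace QBX

/-! ### Gauss–Legendre rule: orthogonality, exactness, weights and nodes. -/

-- Integration by parts moves one derivative from `u` to `s` at each step. The boundary terms
-- vanish, and `n` differentiations annihilate `s`.
open Polynomial in
theorem integral_iterate_derivative_mul_eq_zero (u : Polynomial ℝ) (n : ℕ)
    (h1 : ∀ k < n, (derivative^[k] u).eval 1 = 0)
    (h2 : ∀ k < n, (derivative^[k] u).eval (-1) = 0) (s : Polynomial ℝ) (hs : s.degree < n) :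
    ∫ t in (-1 : ℝ)..1, (derivative^[n] u).eval t * s.eval t = 0 := by
  induction n generalizing s with
  | zero =>
    have : s = 0 := by simpa using hs
    simp [this]
  | succ n ih =>
    have hs' : (derivative s).degree < n := by
      rw [degree_lt_iff_coeff_zero] at hs ⊢
      intro m hm
      rw [coeff_derivative, hs (m + 1) (by omega), zero_mul]
    have key := intervalIntegral.integral_mul_deriv_eq_deriv_mul (a := -1) (b := 1)
      (u := fun t => s.eval t) (v := fun t => (derivative^[n] u).eval t)
      (u' := fun t => (derivative s).eval t) (v' := fun t => (derivative^[n + 1] u).eval t)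
      (fun x _ => s.hasDerivAt x)
      (fun x _ => by
        rw [Function.iterate_succ_apply']
        exact (derivative^[n] u).hasDerivAt x)
      ((derivative s).continuous.intervalIntegrable _ _)
      ((derivative^[n + 1] u).continuous.intervalIntegrable _ _)
    have ih' := ih (fun k hk => h1 k (by omega)) (fun k hk => h2 k (by omega)) _ hs'
    simp_rw [mul_comm (eval _ (derivative^[n+1] u))]
    rw [key, h1 n (by omega), h2 n (by omega)]
    simp_rw [mul_comm (eval _ (derivative s))]
    rw [ih']
    ring

-- In Rodrigues' formula, `(X ^ 2 - 1) ^ (q - k)` divides the `k`-th derivative, so every boundary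
-- term with `k < q` vanishes at `±1`.
open Polynomial in
theorem integral_legendreP_mul_eq_zero (q : ℕ) (s : Polynomial ℝ) (hs : s.degree < q) :
    ∫ t in (-1 : ℝ)..1, (legendreP q).eval t * s.eval t = 0 := by
  have hroot : ∀ a : ℝ, a ^ 2 = 1 → ∀ k < q,
      (derivative^[k] ((X ^ 2 - 1 : Polynomial ℝ) ^ q)).eval a = 0 := by
    intro a ha k hk
    have hd := pow_sub_dvd_iterate_derivative_pow (X ^ 2 - 1 : Polynomial ℝ) q k
    obtain ⟨v, hv⟩ := hd
    rw [hv]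
    have : q - k ≠ 0 := by omega
    simp [ha, this]
  have := integral_iterate_derivative_mul_eq_zero ((X ^ 2 - 1 : Polynomial ℝ) ^ q) q
    (hroot 1 (by norm_num)) (hroot (-1) (by norm_num)) s hs
  simp only [legendreP, eval_mul, eval_C, mul_assoc]
  rw [intervalIntegral.integral_const_mul, this, mul_zero]

open Polynomial in
theorem degree_legendreP (q : ℕ) : (legendreP q).degree = q := by
  have hmonic : ((X ^ 2 - 1 : Polynomial ℝ) ^ q).Monic := by
    have : (X ^ 2 - C 1 : Polynomial ℝ).Monic := monic_X_pow_sub_C 1 (by norm_num)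
    simpa using this.pow q
  have hdeg : ((X ^ 2 - 1 : Polynomial ℝ) ^ q).natDegree = 2 * q := by
    have : (X ^ 2 - C 1 : Polynomial ℝ).natDegree = 2 := natDegree_X_pow_sub_C
    rw [natDegree_pow]
    simp only [map_one] at this
    rw [this, mul_comm]
  rw [legendreP, degree_C_mul (by positivity)]
  refine le_antisymm ?_ ?_
  · rw [degree_le_iff_coeff_zero]
    intro m hm
    have hm : q < m := by exact_mod_cast hm
    rw [coeff_iterate_derivative, coeff_eq_zero_of_natDegree_lt (by omega), smul_zero]
  · refine le_degree_of_ne_zero ?_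
    rw [coeff_iterate_derivative]
    have : ((X ^ 2 - 1 : Polynomial ℝ) ^ q).coeff (q + q) = 1 := by
      rw [← two_mul, ← hdeg]; exact hmonic
    rw [this]
    have : 0 < (q + q).descFactorial q := Nat.descFactorial_pos.2 (by omega)
    simp only [nsmul_eq_mul, mul_one]
    exact_mod_cast this.ne'

namespace IsGaussLegendre

variable {q : ℕ} {y w : Fin q → ℝ}

-- Divide `f` by `legendreP q`. The multiple of `legendreP q` contributes nothing to the integral by
-- orthogonality and nothing to the sum because the nodes are roots. The remainder is its own
-- Lagrange interpolant, which the weights integrate by definition.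
open Polynomial in
theorem exact (H : IsGaussLegendre q y w) (f : Polynomial ℝ)
    (hf : f.degree < (2 * q : ℕ)) : ∑ j, w j * f.eval (y j) = ∫ t in (-1 : ℝ)..1, f.eval t := by
  have hP0 : legendreP q ≠ 0 := by
    intro h
    have := degree_legendreP q
    simp [h] at this
  set s := f / legendreP q
  set r := f % legendreP q
  have hfe : f = legendreP q * s + r := (EuclideanDomain.div_add_mod f _).symm
  have hr : r.degree < q := by
    rw [← degree_legendreP q]; exact EuclideanDomain.mod_lt f hP0
  have hs : s.degree < q := by
    by_cases hle : (legendreP q).degree ≤ f.degree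
    · have h1 := degree_add_div hP0 hle
      rw [degree_legendreP] at h1
      by_cases hs0 : s = 0
      · rw [hs0, degree_zero]; exact WithBot.bot_lt_coe _
      · have h2 : (f / legendreP q).degree = (s.natDegree : WithBot ℕ) := degree_eq_natDegree hs0
        rw [h2] at h1
        rw [← h1] at hf
        rw [degree_eq_natDegree hs0]
        have h3 : q + s.natDegree < 2 * q := by exact_mod_cast hf
        have : s.natDegree < q := by omega
        exact_mod_cast this
    · have : s = 0 := (Polynomial.div_eq_zero_iff hP0).2 (not_le.1 hle)
      rw [this, degree_zero]; exact WithBot.bot_lt_coe _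
  have hrI : r = ∑ j, C (r.eval (y j)) * Lagrange.basis Finset.univ y j := by
    have := Lagrange.eq_interpolate (s := Finset.univ) (v := y) (H.injective.injOn)
      (f := r) (by simpa using hr)
    rw [Lagrange.interpolate_apply] at this
    exact this
  have hval : ∀ j, f.eval (y j) = r.eval (y j) := by
    intro j
    have hj : (legendreP q).eval (y j) = 0 := H.isRoot j
    rw [hfe, eval_add, eval_mul, hj, zero_mul, zero_add]
  have hint : ∫ t in (-1 : ℝ)..1, f.eval t = ∫ t in (-1 : ℝ)..1, r.eval t := by
    have : ∀ t, f.eval t = (legendreP q).eval t * s.eval t + r.eval t := fun t => by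
      conv_lhs => rw [hfe]
      simp
    simp_rw [this]
    rw [intervalIntegral.integral_add, integral_legendreP_mul_eq_zero q s hs, zero_add]
    · exact (((legendreP q).continuous).mul s.continuous).intervalIntegrable _ _
    · exact r.continuous.intervalIntegrable _ _
  rw [hint]
  simp_rw [hval]
  conv_rhs => rw [hrI]
  simp only [eval_finsetSum, eval_mul, eval_C]
  rw [intervalIntegral.integral_finsetSum]
  · refine Finset.sum_congr rfl fun j _ => ?_
    rw [intervalIntegral.integral_const_mul, ← H.weight j, mul_comm]
  · intro j _
    exact (continuous_const.mul (Polynomial.continuous _)).intervalIntegrable _ _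

open Polynomial in
theorem degree_basis_sq (H : IsGaussLegendre q y w) (j : Fin q) :
    (Lagrange.basis Finset.univ y j ^ 2).natDegree + 2 = 2 * q := by
  have h1 := Lagrange.natDegree_basis (s := Finset.univ) (v := y) H.injective.injOn
    (Finset.mem_univ j)
  rw [natDegree_pow, h1]
  have := j.pos
  simp
  omega

-- Exactness applies to the squared basis polynomial, of degree `2 * q - 2`; this form makes the
-- sign of the weight visible.
open Polynomial in
theorem weight_eq (H : IsGaussLegendre q y w) (j : Fin q) :
    w j = ∫ t in (-1 : ℝ)..1, (Lagrange.basis Finset.univ y j ^ 2).eval t := by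
  have h2 := H.degree_basis_sq j
  have hd : (Lagrange.basis Finset.univ y j ^ 2).degree < (2 * q : ℕ) :=
    lt_of_le_of_lt degree_le_natDegree (by exact_mod_cast (by omega))
  rw [← H.exact _ hd, Finset.sum_eq_single j]
  · simp [Lagrange.eval_basis_self H.injective.injOn]
  · intro i _ hij
    simp [Lagrange.eval_basis_of_ne hij.symm (Finset.mem_univ i)]
  · simp

theorem weight_nonneg (H : IsGaussLegendre q y w) (j : Fin q) : 0 ≤ w j := by
  rw [H.weight_eq j]
  refine intervalIntegral.integral_nonneg (by norm_num) fun t _ => ?_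
  rw [Polynomial.eval_pow]
  positivity

theorem sum_weight (H : IsGaussLegendre q y w) (hq : 1 ≤ q) : ∑ j, w j = 2 := by
  have := H.exact 1 (by rw [Polynomial.degree_one]; exact_mod_cast (by omega))
  simp only [Polynomial.eval_one, mul_one] at this
  rw [this]
  norm_num

-- The integrand has degree `2 * q - 1` and vanishes at every node.
open Polynomial in
theorem node_integral (H : IsGaussLegendre q y w) (j : Fin q) :
    ∫ t in (-1 : ℝ)..1, (t - y j) * ((Lagrange.basis Finset.univ y j).eval t) ^ 2 = 0 := by
  have h2 := H.degree_basis_sq j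
  have hd : ((X - C (y j)) * Lagrange.basis Finset.univ y j ^ 2).degree <
      ((2 * q : ℕ) : WithBot ℕ) := by
    have := natDegree_mul_le (p := X - C (y j)) (q := Lagrange.basis Finset.univ y j ^ 2)
    rw [natDegree_X_sub_C] at this
    refine lt_of_le_of_lt degree_le_natDegree (Nat.cast_lt.2 ?_)
    omega
  have := H.exact _ hd
  simp only [eval_mul, eval_sub, eval_X, eval_C, eval_pow] at this
  rw [← this]
  refine Finset.sum_eq_zero fun i _ => ?_
  by_cases hij : i = j
  · simp [hij]
  · rw [Lagrange.eval_basis_of_ne (Ne.symm hij) (Finset.mem_univ i)]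
    simp

-- By `node_integral`, `y j` is the mean of `t` for the density given by the squared basis
-- polynomial. Were it outside `[-1, 1]`, that integrand would have constant sign without vanishing
-- identically.
open Polynomial in
theorem node_mem (H : IsGaussLegendre q y w) (j : Fin q) : y j ∈ Icc (-1 : ℝ) 1 := by
  set b := Lagrange.basis Finset.univ y j
  have hb : b ≠ 0 := Lagrange.basis_ne_zero H.injective.injOn (Finset.mem_univ j)
  have key := H.node_integral j
  have hfin : {t : ℝ | b.eval t = 0}.Finite := by
    have := b.rootSet_finite ℝ
    refine this.subset fun t ht => ?_
    rw [mem_rootSet]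
    exact ⟨hb, by simpa using ht⟩
  have hcont : Continuous fun t => (t - y j) * (b.eval t) ^ 2 := by fun_prop
  obtain ⟨t, ht1, ht2⟩ := ((Ioo_infinite (show (-1 : ℝ) < 1 by norm_num)).sdiff hfin).nonempty
  have hbt : 0 < (b.eval t) ^ 2 := by
    have : b.eval t ≠ 0 := ht2
    positivity
  by_contra hy
  rw [mem_Icc, not_and_or, not_le, not_le] at hy
  rcases hy with hy | hy
  · have := intervalIntegral.integral_pos (a := -1) (b := 1) (by norm_num) hcont.continuousOn
      (fun x hx => mul_nonneg (by linarith [hx.1]) (sq_nonneg _))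
      ⟨t, Ioo_subset_Icc_self ht1, mul_pos (by linarith [ht1.1]) hbt⟩
    exact this.ne' key
  · have := intervalIntegral.integral_pos (a := -1) (b := 1)
      (f := fun t => -((t - y j) * (b.eval t) ^ 2)) (by norm_num) hcont.neg.continuousOn
      (fun x hx => by
        have := mul_nonneg (a := y j - x) (by linarith [hx.2]) (sq_nonneg (b.eval x))
        linarith)
      ⟨t, Ioo_subset_Icc_self ht1, by
        have := mul_pos (a := y j - t) (by linarith [ht1.2]) hbt
        linarith⟩
    rw [intervalIntegral.integral_neg, key] at this
    simp at this

end IsGaussLegendre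

/-! ### Quadrature error on an interval and on a square. -/

namespace IsGaussLegendre

variable {q : ℕ} {y w : Fin q → ℝ}

theorem node_scaled_mem (H : IsGaussLegendre q y w) {h : ℝ} (hh : 0 < h) (j : Fin q) :
    h / 2 * (y j + 1) ∈ Icc 0 h := by
  have := H.node_mem j
  constructor
  · have := this.1
    exact mul_nonneg (by positivity) (by linarith)
  · nlinarith [this.2]

theorem norm_sum_weight_mul_le (H : IsGaussLegendre q y w) (hq : 1 ≤ q) {g : Fin q → ℂ} {B : ℝ}
    (hg : ∀ j, ‖g j‖ ≤ B) : ‖∑ j, (w j : ℂ) * g j‖ ≤ 2 * B := by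
  refine (norm_sum_le _ _).trans ?_
  rw [← H.sum_weight hq, Finset.sum_mul]
  refine Finset.sum_le_sum fun j _ => ?_
  rw [norm_mul, Complex.norm_real, Real.norm_of_nonneg (H.weight_nonneg j)]
  exact mul_le_mul_of_nonneg_left (hg j) (H.weight_nonneg j)

theorem scaled_pow (H : IsGaussLegendre q y w) (h : ℝ) {k : ℕ} (hk : k < 2 * q) :
    h / 2 * ∑ j, w j * (h / 2 * (y j + 1)) ^ k = ∫ t in (0 : ℝ)..h, t ^ k := by
  have hd : ((Polynomial.C (h / 2) * (Polynomial.X + 1)) ^ k : Polynomial ℝ).degree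
      < (2 * q : ℕ) := by
    refine lt_of_le_of_lt Polynomial.degree_le_natDegree (Nat.cast_lt.2 ?_)
    refine lt_of_le_of_lt ?_ hk
    refine Polynomial.natDegree_pow_le.trans ?_
    have : (Polynomial.C (h / 2) * (Polynomial.X + 1) : Polynomial ℝ).natDegree ≤ 1 := by
      compute_degree
    nlinarith
  have := H.exact _ hd
  simp only [Polynomial.eval_pow, Polynomial.eval_mul, Polynomial.eval_C, Polynomial.eval_add,
    Polynomial.eval_X, Polynomial.eval_one] at this
  rw [this]
  have h2 := intervalIntegral.mul_integral_comp_mul_add (a := -1) (b := 1)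
    (f := fun t : ℝ => t ^ k) (h / 2) (h / 2)
  simp only [mul_add, mul_one]
  rw [h2]
  congr 1 <;> ring

/-- The error of the Gauss–Legendre rule, transplanted to `[0, h]`. -/
theorem norm_error_le (H : IsGaussLegendre q y w) (hq : 1 ≤ q) {h M : ℝ} (hh : 0 < h)
    {f : ℝ → ℂ} (hf : ContDiffOn ℝ (2 * q : ℕ) f (Icc 0 h))
    (hM : ∀ t ∈ Icc 0 h, ‖iteratedDerivWithin (2 * q) f (Icc 0 h) t‖ ≤ M) :
    ‖((h / 2 : ℝ) : ℂ) * ∑ j, (w j : ℂ) * f (h / 2 * (y j + 1)) - ∫ t in (0 : ℝ)..h, f t‖ ≤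
      2 * M * h ^ (2 * q + 1) := by
  -- `n = 2 * q - 1` is the highest degree integrated exactly, so the Taylor polynomial cancels from
  -- the error. The remainder is at most `M * h ^ (2 * q)` (the factorial is dropped), and its
  -- quadrature sum and its integral each contribute a factor `h`.
  obtain ⟨n, hn⟩ : ∃ n, 2 * q = n + 1 := ⟨2 * q - 1, by omega⟩
  have hM0 : 0 ≤ M := (norm_nonneg _).trans (hM 0 ⟨le_rfl, hh.le⟩)
  set T : ℝ → ℂ := taylorWithinEval f n (Icc 0 h) 0 with hT
  have hTa : ∀ t, T t = ∑ k ∈ Finset.range (n + 1),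
      (((k.factorial : ℝ)⁻¹ • iteratedDerivWithin k f (Icc 0 h) 0) * ((t ^ k : ℝ) : ℂ)) := by
    intro t
    rw [hT, taylor_within_apply]
    refine Finset.sum_congr rfl fun k _ => ?_
    simp only [sub_zero, Complex.real_smul]
    push_cast
    ring
  have hTc : Continuous T := by
    rw [show T = _ from funext hTa]
    fun_prop
  have hR : ∀ t ∈ Icc 0 h, ‖f t - T t‖ ≤ M * h ^ (2 * q) := by
    intro t ht
    have hf' : ContDiffOn ℝ (n + 1) f (Icc 0 h) := by
      rw [hn] at hf; exact_mod_cast hf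
    rw [hn] at hM ⊢
    have h1 := taylor_mean_remainder_bound hh.le hf' ht hM
    refine h1.trans ?_
    rw [sub_zero]
    have h2 : (1 : ℝ) ≤ (n.factorial : ℝ) := by exact_mod_cast n.factorial_pos
    refine (div_le_self (mul_nonneg hM0 (pow_nonneg ht.1 _)) h2).trans ?_
    exact mul_le_mul_of_nonneg_left (pow_le_pow_left₀ ht.1 ht.2 _) hM0
  have hexact : ((h / 2 : ℝ) : ℂ) * ∑ j, (w j : ℂ) * T (h / 2 * (y j + 1)) =
      ∫ t in (0 : ℝ)..h, T t := by
    simp_rw [hTa]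
    rw [intervalIntegral.integral_finsetSum]
    · simp_rw [Finset.mul_sum]
      rw [Finset.sum_comm]
      refine Finset.sum_congr rfl fun k hk => ?_
      rw [intervalIntegral.integral_const_mul, intervalIntegral.integral_ofReal,
        ← H.scaled_pow h (by rw [hn]; exact Finset.mem_range.1 hk)]
      push_cast
      rw [Finset.mul_sum, Finset.mul_sum]
      refine Finset.sum_congr rfl fun j _ => ?_
      ring
    · intro k _
      exact Continuous.intervalIntegrable (by fun_prop) _ _
  have hfi : IntervalIntegrable f volume 0 h := by
    apply ContinuousOn.intervalIntegrable
    rw [uIcc_of_le hh.le]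
    exact hf.continuousOn
  have e1 : ((h / 2 : ℝ) : ℂ) * ∑ j, (w j : ℂ) * f (h / 2 * (y j + 1)) - ∫ t in (0 : ℝ)..h, f t
      = ((h / 2 : ℝ) : ℂ) * ∑ j, (w j : ℂ) * (f (h / 2 * (y j + 1)) - T (h / 2 * (y j + 1)))
        - ∫ t in (0 : ℝ)..h, (f t - T t) := by
    rw [intervalIntegral.integral_sub hfi (hTc.intervalIntegrable _ _), ← hexact]
    simp_rw [mul_sub]
    rw [Finset.sum_sub_distrib]
    ring
  rw [e1]
  have b1 : ‖((h / 2 : ℝ) : ℂ) * ∑ j, (w j : ℂ) *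
      (f (h / 2 * (y j + 1)) - T (h / 2 * (y j + 1)))‖ ≤ h / 2 * (2 * (M * h ^ (2 * q))) := by
    rw [norm_mul, Complex.norm_real, Real.norm_of_nonneg (by positivity)]
    exact mul_le_mul_of_nonneg_left
      (H.norm_sum_weight_mul_le hq fun j => hR _ (H.node_scaled_mem hh j)) (by positivity)
  have b2 : ‖∫ t in (0 : ℝ)..h, (f t - T t)‖ ≤ M * h ^ (2 * q) * |h - 0| :=
    intervalIntegral.norm_integral_le_of_norm_le_const fun t ht => by
      rw [uIoc_of_le hh.le] at ht
      exact hR t (Ioc_subset_Icc_self ht)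
  rw [sub_zero, abs_of_pos hh] at b2
  refine (norm_sub_le _ _).trans ((add_le_add b1 b2).trans (le_of_eq ?_))
  rw [pow_succ]
  ring

/-- The error of the tensor product Gauss–Legendre rule, transplanted to `[0, h]²`. -/
theorem norm_tensor_error_le (H : IsGaussLegendre q y w) (hq : 1 ≤ q) {h M : ℝ} (hh : 0 < h)
    {F : ℝ × ℝ → ℂ} (hF : ContDiffOn ℝ (2 * q : ℕ) F (square h))
    (hM1 : ∀ t ∈ Icc 0 h, ∀ s ∈ Icc 0 h,
      ‖iteratedDerivWithin (2 * q) (fun t => F (t, s)) (Icc 0 h) t‖ ≤ M)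
    (hM2 : ∀ t ∈ Icc 0 h, ∀ s ∈ Icc 0 h,
      ‖iteratedDerivWithin (2 * q) (fun s => F (t, s)) (Icc 0 h) s‖ ≤ M) :
    ‖∑ i, ∑ j, (w i : ℂ) * (w j : ℂ) * F (h / 2 * (y i + 1), h / 2 * (y j + 1)) *
        (((h / 2) ^ 2 : ℝ) : ℂ) - ∫ x in square h, F x‖ ≤ 4 * M * h ^ (2 * q + 2) := by
  have hd1 : ∀ s ∈ Icc 0 h, ContDiffOn ℝ (2 * q : ℕ) (fun t => F (t, s)) (Icc 0 h) := fun s hs =>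
    hF.comp (t := square h) (by fun_prop) fun t ht => ⟨ht, hs⟩
  have hd2 : ∀ t ∈ Icc 0 h, ContDiffOn ℝ (2 * q : ℕ) (fun s => F (t, s)) (Icc 0 h) := fun t ht =>
    hF.comp (t := square h) (by fun_prop) fun s hs => ⟨ht, hs⟩
  have E1 : ∀ s ∈ Icc 0 h, ‖((h / 2 : ℝ) : ℂ) * ∑ i, (w i : ℂ) * F (h / 2 * (y i + 1), s) -
      ∫ t in (0 : ℝ)..h, F (t, s)‖ ≤ 2 * M * h ^ (2 * q + 1) := fun s hs =>
    H.norm_error_le hq hh (f := fun t => F (t, s)) (hd1 s hs) (fun t ht => hM1 t ht s hs)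
  have E2 : ∀ t ∈ Icc 0 h, ‖((h / 2 : ℝ) : ℂ) * ∑ j, (w j : ℂ) * F (t, h / 2 * (y j + 1)) -
      ∫ s in (0 : ℝ)..h, F (t, s)‖ ≤ 2 * M * h ^ (2 * q + 1) := fun t ht =>
    H.norm_error_le hq hh (f := fun s => F (t, s)) (hd2 t ht) (fun s hs => hM2 t ht s hs)
  have hint : IntegrableOn F (square h) :=
    hF.continuousOn.integrableOn_compact (isCompact_Icc.prod isCompact_Icc)
  have hint' : Integrable F ((volume.restrict (Icc 0 h)).prod (volume.restrict (Icc 0 h))) := by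
    rw [Measure.prod_restrict]
    exact hint
  have hI : ∫ x in square h, F x = ∫ s in (0 : ℝ)..h, ∫ t in (0 : ℝ)..h, F (t, s) := by
    have e1 : ∫ x in square h, F x =
        ∫ x, F x ∂((volume.restrict (Icc 0 h)).prod (volume.restrict (Icc 0 h))) := by
      rw [Measure.prod_restrict]; rfl
    rw [e1, integral_prod_symm F hint', intervalIntegral.integral_of_le hh.le,
      ← integral_Icc_eq_integral_Ioc]
    simp_rw [intervalIntegral.integral_of_le hh.le, ← integral_Icc_eq_integral_Ioc]
  have hIint : IntervalIntegrable (fun s => ∫ t in (0 : ℝ)..h, F (t, s)) volume 0 h := by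
    rw [intervalIntegrable_iff_integrableOn_Icc_of_le hh.le]
    simp_rw [intervalIntegral.integral_of_le hh.le, ← integral_Icc_eq_integral_Ioc]
    exact hint'.integral_prod_right
  set a : Fin q → ℝ := fun j => h / 2 * (y j + 1)
  set κ : ℂ := ((h / 2 : ℝ) : ℂ)
  have ha : ∀ j, a j ∈ Icc 0 h := fun j => H.node_scaled_mem hh j
  have hki : ∀ i, IntervalIntegrable (fun s => F (a i, s)) volume 0 h := fun i => by
    apply ContinuousOn.intervalIntegrable
    rw [uIcc_of_le hh.le]
    exact (hd2 _ (ha i)).continuousOn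
  have hsumint : ∫ s in (0 : ℝ)..h, κ * ∑ i, (w i : ℂ) * F (a i, s) =
      κ * ∑ i, (w i : ℂ) * ∫ s in (0 : ℝ)..h, F (a i, s) := by
    rw [intervalIntegral.integral_const_mul, intervalIntegral.integral_finsetSum]
    · simp_rw [intervalIntegral.integral_const_mul]
    · intro i _
      exact (hki i).const_mul _
  have hii : IntervalIntegrable (fun s => κ * ∑ i, (w i : ℂ) * F (a i, s)) volume 0 h := by
    refine IntervalIntegrable.const_mul ?_ _
    have := IntervalIntegrable.sum (μ := volume) (a := 0) (b := h) Finset.univ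
      (f := fun i s => (w i : ℂ) * F (a i, s)) fun i _ => (hki i).const_mul _
    simpa [Finset.sum_fn] using this
  -- The mixed term, a quadrature sum in the first variable and an integral in the second, is
  -- inserted between the two sides. Each difference is then a one-dimensional error.
  have split : ∑ i, ∑ j, (w i : ℂ) * (w j : ℂ) * F (a i, a j) * (((h / 2) ^ 2 : ℝ) : ℂ)
        - ∫ x in square h, F x
      = κ * ∑ i, (w i : ℂ) * (κ * ∑ j, (w j : ℂ) * F (a i, a j) - ∫ s in (0 : ℝ)..h, F (a i, s))
        + ∫ s in (0 : ℝ)..h,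
          (κ * ∑ i, (w i : ℂ) * F (a i, s) - ∫ t in (0 : ℝ)..h, F (t, s)) := by
    rw [intervalIntegral.integral_sub hii hIint, hsumint, hI]
    simp_rw [mul_sub]
    rw [Finset.sum_sub_distrib, mul_sub]
    have : ∑ i, ∑ j, (w i : ℂ) * (w j : ℂ) * F (a i, a j) * (((h / 2) ^ 2 : ℝ) : ℂ) =
        κ * ∑ i, (w i : ℂ) * (κ * ∑ j, (w j : ℂ) * F (a i, a j)) := by
      simp_rw [Finset.mul_sum]
      refine Finset.sum_congr rfl fun i _ => Finset.sum_congr rfl fun j _ => ?_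
      simp only [κ]
      push_cast
      ring
    rw [this]
    ring
  rw [split]
  have b1 : ‖κ * ∑ i, (w i : ℂ) * (κ * ∑ j, (w j : ℂ) * F (a i, a j) -
      ∫ s in (0 : ℝ)..h, F (a i, s))‖ ≤ h / 2 * (2 * (2 * M * h ^ (2 * q + 1))) := by
    rw [norm_mul, Complex.norm_real, Real.norm_of_nonneg (by positivity)]
    exact mul_le_mul_of_nonneg_left (H.norm_sum_weight_mul_le hq fun j =>
      E2 _ (ha j)) (by positivity)
  have b2 : ‖∫ s in (0 : ℝ)..h,
      (κ * ∑ i, (w i : ℂ) * F (a i, s) - ∫ t in (0 : ℝ)..h, F (t, s))‖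
      ≤ 2 * M * h ^ (2 * q + 1) * |h - 0| :=
    intervalIntegral.norm_integral_le_of_norm_le_const fun s hs => by
      rw [uIoc_of_le hh.le] at hs
      exact E1 s (Ioc_subset_Icc_self hs)
  rw [sub_zero, abs_of_pos hh] at b2
  refine (norm_add_le _ _).trans ((add_le_add b1 b2).trans (le_of_eq ?_))
  ring

end IsGaussLegendre

/-! ### Derivatives of homogeneous functions and derivatives along lines. -/

section Homogeneous

variable {E : Type*} [NormedAddCommGroup E] [NormedSpace ℝ E]

/-- Derivatives of a function that is homogeneous of degree `-a` and smooth away from the origin. -/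
theorem exists_norm_iteratedFDeriv_le_of_homogeneous [FiniteDimensional ℝ E] {f : E → ℂ} (a : ℕ)
    (hf : ∀ z ≠ 0, ContDiffAt ℝ (⊤ : ℕ∞) f z)
    (hom : ∀ l : ℝ, 0 < l → ∀ z, f (l • z) = ((l ^ a)⁻¹ : ℝ) • f z) (j : ℕ) :
    ∃ B, 0 ≤ B ∧ ∀ z ≠ 0, ‖iteratedFDeriv ℝ j f z‖ ≤ B / ‖z‖ ^ (a + j) := by
  have hcont : ContinuousOn (fun z => ‖iteratedFDeriv ℝ j f z‖) (Metric.sphere (0 : E) 1) := by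
    intro z hz
    have hz0 : z ≠ 0 := by
      rintro rfl
      simp at hz
    have h1 : ContDiffAt ℝ 0 (iteratedFDeriv ℝ j f) z :=
      (hf z hz0).iteratedFDeriv_right (by
        rw [zero_add]; exact_mod_cast le_top)
    exact h1.continuousAt.norm.continuousWithinAt
  obtain ⟨B, hB⟩ := (isCompact_sphere (0 : E) 1).bddAbove_image hcont
  -- The sphere is empty when `E` is trivial, and `B` could then be negative.
  refine ⟨max B 0, le_max_right _ _, fun z hz => ?_⟩
  have hl : 0 < ‖z‖ := norm_pos_iff.2 hz
  have hu : ‖iteratedFDeriv ℝ j f (‖z‖⁻¹ • z)‖ ≤ max B 0 :=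
    (hB ⟨_, by simp [norm_smul, hl.ne'], rfl⟩).trans (le_max_left _ _)
  have hfun : (fun x => f (‖z‖⁻¹ • x)) = fun x => (‖z‖ ^ a) • f x := by
    funext x
    rw [hom _ (inv_pos.2 hl), inv_pow, inv_inv]
  set g : E ≃L[ℝ] E := ContinuousLinearEquiv.smulLeft (Units.mk0 ‖z‖⁻¹ (inv_pos.2 hl).ne')
  -- The derivative of the rescaled function is computed twice: the chain rule (`e1`) gives a factor
  -- of norm at most `‖z‖⁻¹ ^ j`, homogeneity (`e2`) gives `‖z‖ ^ a`.
  have e1 : iteratedFDeriv ℝ j (fun x => f (‖z‖⁻¹ • x)) z =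
      (iteratedFDeriv ℝ j f (‖z‖⁻¹ • z)).compContinuousLinearMap
        fun _ => (g : E →L[ℝ] E) := by
    simp only [← iteratedFDerivWithin_univ]
    exact g.iteratedFDerivWithin_comp_right f uniqueDiffOn_univ (x := z) (mem_univ _) j
  have hg : ‖(g : E →L[ℝ] E)‖ ≤ ‖z‖⁻¹ := by
    refine ContinuousLinearMap.opNorm_le_bound _ (by positivity) fun x => ?_
    have : (g : E →L[ℝ] E) x = ‖z‖⁻¹ • x := rfl
    rw [this, norm_smul, norm_inv, norm_norm]
  have e2 : iteratedFDeriv ℝ j (fun x => f (‖z‖⁻¹ • x)) z = (‖z‖ ^ a) • iteratedFDeriv ℝ j f z := by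
    rw [hfun]
    exact iteratedFDeriv_const_smul_apply' ((hf z hz).of_le (by exact_mod_cast le_top))
  have h3 : ‖z‖ ^ a * ‖iteratedFDeriv ℝ j f z‖ ≤ max B 0 * (‖z‖⁻¹) ^ j := by
    have : ‖(‖z‖ ^ a) • iteratedFDeriv ℝ j f z‖ ≤ max B 0 * (‖z‖⁻¹) ^ j := by
      rw [← e2, e1]
      refine (ContinuousMultilinearMap.norm_compContinuousLinearMap_le _ _).trans ?_
      rw [Finset.prod_const, Finset.card_univ, Fintype.card_fin]
      gcongr
    rwa [norm_smul, norm_pow, norm_norm] at this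
  rw [le_div_iff₀ (by positivity), pow_add]
  rw [inv_pow, ← div_eq_mul_inv, le_div_iff₀ (by positivity)] at h3
  linarith

end Homogeneous

/-- Iterated derivatives along a line are directional derivatives. -/
theorem iteratedDerivWithin_comp_line {E : Type*} [NormedAddCommGroup E] [NormedSpace ℝ E]
    {f : E → ℂ} {S : Set E} {I : Set ℝ} (hS : UniqueDiffOn ℝ S) (hI : UniqueDiffOn ℝ I) {N : ℕ}
    (hf : ContDiffOn ℝ N f S) (p v : E) (hmaps : ∀ t ∈ I, p + t • v ∈ S) (j : ℕ) (hj : j ≤ N) :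
    ∀ t ∈ I, iteratedDerivWithin j (fun t => f (p + t • v)) I t =
      iteratedFDerivWithin ℝ j f S (p + t • v) (fun _ => v) := by
  induction j with
  | zero => intro t _; simp
  | succ j ih =>
    intro t ht
    have ih' := ih (by omega)
    have hL : HasDerivWithinAt (fun t : ℝ => p + t • v) v I t := by
      simpa using (((hasDerivAt_id t).smul_const v).const_add p).hasDerivWithinAt
    have hD : HasFDerivWithinAt (iteratedFDerivWithin ℝ j f S)
        (fderivWithin ℝ (iteratedFDerivWithin ℝ j f S) S (p + t • v)) S (p + t • v) :=
      (hf.differentiableOn_iteratedFDerivWithin (by exact_mod_cast hj) hS _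
        (hmaps t ht)).hasFDerivWithinAt
    have hc := hD.comp_hasDerivWithinAt t hL hmaps
    have ha := ((ContinuousMultilinearMap.apply ℝ (fun _ : Fin j => E) ℂ
      (fun _ => v)).hasFDerivAt.comp_hasDerivWithinAt t hc)
    rw [iteratedDerivWithin_succ, derivWithin_congr ih' (ih' t ht),
      iteratedFDerivWithin_succ_apply_left]
    exact ha.derivWithin (hI t ht)

/-! ### The kernel -/

/-- The kernel `‖z‖^{-(n+1)} Y_n^m(z)`. -/
noncomputable def multipoleKernel (n : ℕ) (m : ℤ) (z : E3) : ℂ :=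
  sphericalHarmonicAt n m z / ((‖z‖ ^ (n + 1) : ℝ) : ℂ)

theorem multipoleKernel_smul (n : ℕ) (m : ℤ) (l : ℝ) (hl : 0 < l) (z : E3) :
    multipoleKernel n m (l • z) = ((l ^ (n + 1))⁻¹ : ℝ) • multipoleKernel n m z := by
  have h1 : polarAngle (l • z) = polarAngle z := by
    simp only [polarAngle, norm_smul, Real.norm_of_nonneg hl.le, PiLp.smul_apply, smul_eq_mul]
    rw [mul_div_mul_left _ _ hl.ne']
  have h2 : azimuthAngle (l • z) = azimuthAngle z := by
    simp only [azimuthAngle, PiLp.smul_apply, smul_eq_mul]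
    rw [← Complex.arg_real_mul ⟨z 0, z 1⟩ hl]
    congr 1
    apply Complex.ext <;> simp
  simp only [multipoleKernel, sphericalHarmonicAt, h1, h2, norm_smul, Real.norm_of_nonneg hl.le,
    Complex.real_smul]
  push_cast
  rw [mul_pow, div_eq_mul_inv, div_eq_mul_inv, mul_inv]
  ring

/-- The complex number whose argument is the azimuth, conjugated for negative orders. -/
noncomputable def planarPart (m : ℤ) (z : E3) : ℂ :=
  (z 0 : ℂ) + (if 0 ≤ m then Complex.I else -Complex.I) * (z 1 : ℂ)

/-- This is the polar form raised to the power `|m|`, conjugated if `m < 0`. It also holds on the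
polar axis, whatever value the azimuth takes there. -/
theorem norm_planar_mul_exp (m : ℤ) (z : E3) :
    ((‖(⟨z 0, z 1⟩ : ℂ)‖ ^ m.natAbs : ℝ) : ℂ) *
      Complex.exp (Complex.I * (m : ℂ) * (azimuthAngle z : ℂ)) = planarPart m z ^ m.natAbs := by
  set ζ : ℂ := ⟨z 0, z 1⟩ with hζ
  have h0 : (‖ζ‖ : ℂ) * Complex.exp (Complex.arg ζ * Complex.I) = ζ :=
    Complex.norm_mul_exp_arg_mul_I ζ
  have hz : ζ = (z 0 : ℂ) + Complex.I * (z 1 : ℂ) := by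
    apply Complex.ext <;> simp [hζ]
  rcases le_or_gt 0 m with hm | hm
  · obtain ⟨k, rfl⟩ := Int.eq_ofNat_of_zero_le hm
    have : Complex.exp (Complex.I * ((k : ℤ) : ℂ) * (azimuthAngle z : ℂ)) =
        Complex.exp (Complex.arg ζ * Complex.I) ^ k := by
      rw [← Complex.exp_nat_mul]
      congr 1
      simp only [azimuthAngle, Int.cast_natCast, ← hζ]
      ring
    rw [this, Int.natAbs_natCast]
    push_cast
    rw [← mul_pow, h0, planarPart, if_pos hm, hz]
  · obtain ⟨k, hk⟩ := Int.eq_ofNat_of_zero_le (neg_nonneg.2 hm.le)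
    obtain rfl : m = -(k : ℤ) := by omega
    have : Complex.exp (Complex.I * ((-(k : ℤ) : ℤ) : ℂ) * (azimuthAngle z : ℂ)) =
        (starRingEnd ℂ) (Complex.exp (Complex.arg ζ * Complex.I)) ^ k := by
      rw [← Complex.exp_conj, ← Complex.exp_nat_mul]
      congr 1
      simp only [azimuthAngle, Int.cast_neg, Int.cast_natCast, ← hζ, map_mul, Complex.conj_ofReal,
        Complex.conj_I]
      ring
    rw [this, Int.natAbs_neg, Int.natAbs_natCast]
    push_cast
    have hc : (‖ζ‖ : ℂ) * (starRingEnd ℂ) (Complex.exp (Complex.arg ζ * Complex.I)) =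
        (starRingEnd ℂ) ζ := by
      conv_rhs => rw [← h0]
      rw [map_mul, Complex.conj_ofReal]
    rw [← mul_pow, hc, planarPart, if_neg (not_le.2 hm), hz]
    simp

/-- The angles are not smooth on the polar axis, and the azimuth jumps across its branch cut. The
factor `sin θ ^ |m|` from the associated Legendre function combines with the exponential into a
power of `planarPart`, leaving only functions smooth off the origin. -/
theorem sphericalHarmonicAt_eq (n : ℕ) (m : ℤ) :
    ∃ (a : ℂ) (Q : Polynomial ℝ), ∀ z : E3, z ≠ 0 → sphericalHarmonicAt n m z =
      a * ((Q.eval (z 2 * ‖z‖⁻¹) : ℝ) : ℂ) * (planarPart m z * ((‖z‖⁻¹ : ℝ) : ℂ)) ^ m.natAbs := by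
  refine ⟨((Real.sqrt ((2 * (n : ℝ) + 1) / (4 * Real.pi) *
    (((n - m.natAbs).factorial : ℝ) / ((n + m.natAbs).factorial : ℝ))) * (-1) ^ m.natAbs : ℝ) : ℂ),
    Polynomial.derivative^[m.natAbs] (legendreP n), fun z hz => ?_⟩
  have hl : 0 < ‖z‖ := norm_pos_iff.2 hz
  have hsq : ‖z‖ ^ 2 = z 0 ^ 2 + z 1 ^ 2 + z 2 ^ 2 := by
    rw [EuclideanSpace.norm_sq_eq, Fin.sum_univ_three]
    simp
  have hcos : Real.cos (polarAngle z) = z 2 * ‖z‖⁻¹ := by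
    have : |z 2| ≤ ‖z‖ := by
      rw [← Real.norm_eq_abs]
      exact PiLp.norm_apply_le z 2
    have h2 := abs_le.1 this
    rw [polarAngle, Real.cos_arccos, div_eq_mul_inv]
    · rw [le_div_iff₀ hl]; linarith
    · rw [div_le_iff₀ hl]; linarith
  have hsin : Real.sqrt (1 - (z 2 * ‖z‖⁻¹) ^ 2) = ‖(⟨z 0, z 1⟩ : ℂ)‖ * ‖z‖⁻¹ := by
    have : 1 - (z 2 * ‖z‖⁻¹) ^ 2 = (‖(⟨z 0, z 1⟩ : ℂ)‖ * ‖z‖⁻¹) ^ 2 := by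
      rw [mul_pow ‖(⟨z 0, z 1⟩ : ℂ)‖, Complex.sq_norm, Complex.normSq_mk]
      field_simp
      linarith
    rw [this, Real.sqrt_sq (by positivity)]
  rw [sphericalHarmonicAt, sphericalHarmonic, assocLegendre, hcos, hsin, mul_pow, mul_pow,
    ← norm_planar_mul_exp]
  push_cast
  ring

theorem contDiffAt_multipoleKernel (n : ℕ) (m : ℤ) (z : E3) (hz : z ≠ 0) :
    ContDiffAt ℝ (⊤ : ℕ∞) (multipoleKernel n m) z := by
  obtain ⟨a, Q, h⟩ := sphericalHarmonicAt_eq n m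
  have hev : multipoleKernel n m =ᶠ[nhds z] fun z =>
      a * ((Q.eval (z 2 * ‖z‖⁻¹) : ℝ) : ℂ) * (planarPart m z * ((‖z‖⁻¹ : ℝ) : ℂ)) ^ m.natAbs *
        (((‖z‖⁻¹) ^ (n + 1) : ℝ) : ℂ) := by
    filter_upwards [isOpen_ne.mem_nhds hz] with x hx
    rw [multipoleKernel, h x hx, inv_pow, Complex.ofReal_inv (‖x‖ ^ (n + 1)), div_eq_mul_inv]
  refine ContDiffAt.congr_of_eventuallyEq ?_ hev
  have hc : ∀ i, ContDiffAt ℝ (⊤ : ℕ∞) (fun z : E3 => z i) z := fun i =>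
    ((EuclideanSpace.proj i : E3 →L[ℝ] ℝ).contDiff).contDiffAt
  have hn : ContDiffAt ℝ (⊤ : ℕ∞) (fun z : E3 => ‖z‖⁻¹) z :=
    (contDiffAt_norm ℝ hz).inv (norm_ne_zero_iff.2 hz)
  have hof : ∀ {g : E3 → ℝ}, ContDiffAt ℝ (⊤ : ℕ∞) g z →
      ContDiffAt ℝ (⊤ : ℕ∞) (fun z => ((g z : ℝ) : ℂ)) z := fun hg =>
    (Complex.ofRealCLM.contDiff.contDiffAt).comp z hg
  have hQ : ContDiffAt ℝ (⊤ : ℕ∞) (fun z : E3 => Q.eval (z 2 * ‖z‖⁻¹)) z := by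
    have hQ' : ContDiff ℝ (⊤ : ℕ∞) fun x : ℝ => Q.eval x := by
      simpa using Q.contDiff_aeval (𝕜 := ℝ) (⊤ : ℕ∞)
    exact hQ'.contDiffAt.comp z ((hc 2).mul hn)
  have hp : ContDiffAt ℝ (⊤ : ℕ∞) (fun z => planarPart m z) z :=
    (hof (hc 0)).add (contDiffAt_const.mul (hof (hc 1)))
  exact ((contDiffAt_const.mul (hof hQ)).mul ((hp.mul (hof hn)).pow _)).mul (hof (hn.pow _))

/-! ### The `C^k` norm bounds partial derivatives. -/

theorem uniqueDiffOn_square {h : ℝ} (hh : 0 < h) : UniqueDiffOn ℝ (square h) :=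
  (uniqueDiffOn_Icc hh).prod (uniqueDiffOn_Icc hh)

/-- Derivatives up to order `k` are continuous on the compact square. Without boundedness the real
`sSup` would be `0` and would dominate nothing. -/
theorem bddAbove_ckNorm {k : ℕ} {h : ℝ} (hh : 0 < h) {μ : E3 → ℂ}
    (hμ : ContDiffOn ℝ k (onSquare μ) (square h)) :
    BddAbove {a : ℝ | ∃ j ≤ k, ∃ i : Fin j → Fin 2, ∃ x ∈ square h,
      a = ‖iteratedFDerivWithin ℝ j (onSquare μ) (square h) x (fun l => basisVec (i l))‖} := by
  have hK : IsCompact (square h) := isCompact_Icc.prod isCompact_Icc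
  have hb : ∀ j, ∃ B, j ≤ k → ∀ x ∈ square h,
      ‖iteratedFDerivWithin ℝ j (onSquare μ) (square h) x‖ ≤ B := by
    intro j
    by_cases hj : j ≤ k
    · obtain ⟨B, hB⟩ := hK.exists_bound_of_continuousOn
        (hμ.continuousOn_iteratedFDerivWithin (by exact_mod_cast hj) (uniqueDiffOn_square hh))
      exact ⟨B, fun _ => hB⟩
    · exact ⟨0, fun h => absurd h hj⟩
  choose B hB using hb
  refine ⟨∑ j ∈ Finset.range (k + 1), |B j|, ?_⟩
  rintro a ⟨j, hj, i, x, hx, rfl⟩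
  have hv : ∀ l, ‖basisVec (i l)‖ ≤ 1 := by
    intro l
    generalize i l = e
    fin_cases e <;> simp [basisVec, Prod.norm_def]
  calc _ ≤ ‖iteratedFDerivWithin ℝ j (onSquare μ) (square h) x‖ * ∏ l, ‖basisVec (i l)‖ :=
        ContinuousMultilinearMap.le_opNorm _ _
    _ ≤ B j * 1 := by
        refine mul_le_mul (hB j hj x hx) (Finset.prod_le_one (fun _ _ => norm_nonneg _)
          fun l _ => hv l) (by positivity) ((norm_nonneg _).trans (hB j hj x hx))
    _ ≤ |B j| := by rw [mul_one]; exact le_abs_self _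
    _ ≤ _ := Finset.single_le_sum (f := fun j => |B j|) (fun _ _ => abs_nonneg _)
        (Finset.mem_range.2 (by omega))

theorem norm_partial_le_ckNorm {k : ℕ} {h : ℝ} (hh : 0 < h) {μ : E3 → ℂ}
    (hμ : ContDiffOn ℝ k (onSquare μ) (square h)) {j : ℕ} (hj : j ≤ k) (e : Fin 2)
    {x : ℝ × ℝ} (hx : x ∈ square h) :
    ‖iteratedFDerivWithin ℝ j (onSquare μ) (square h) x (fun _ => basisVec e)‖ ≤
      ckNorm k h μ :=
  le_csSup (bddAbove_ckNorm hh hμ) ⟨j, hj, fun _ => e, x, hx, rfl⟩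

/-! ### Derivative bounds for the kernel and for density times kernel. -/

/-- Only finitely many triples `(n, m, j)` occur, so the sum of their constants serves for all. -/
theorem exists_norm_iteratedFDeriv_multipoleKernel_le (p N : ℕ) :
    ∃ B, 0 ≤ B ∧ ∀ (n : ℕ) (m : ℤ), n ≤ p → |m| ≤ (n : ℤ) → ∀ j ≤ N, ∀ z ≠ 0,
      ‖iteratedFDeriv ℝ j (multipoleKernel n m) z‖ ≤ B / ‖z‖ ^ (n + 1 + j) := by
  have hex : ∀ (n : ℕ) (m : ℤ) (j : ℕ), ∃ B, 0 ≤ B ∧ ∀ z ≠ 0,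
      ‖iteratedFDeriv ℝ j (multipoleKernel n m) z‖ ≤ B / ‖z‖ ^ (n + 1 + j) := fun n m j =>
    exists_norm_iteratedFDeriv_le_of_homogeneous (n + 1) (contDiffAt_multipoleKernel n m)
      (multipoleKernel_smul n m) j
  choose B hB0 hB using hex
  refine ⟨∑ x ∈ Finset.range (p + 1) ×ˢ Finset.Icc (-(p : ℤ)) p ×ˢ Finset.range (N + 1),
    B x.1 x.2.1 x.2.2, Finset.sum_nonneg fun _ _ => hB0 _ _ _, fun n m hn hm j hj z hz => ?_⟩
  refine (hB n m j z hz).trans ?_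
  gcongr
  refine Finset.single_le_sum (f := fun x : ℕ × ℤ × ℕ => B x.1 x.2.1 x.2.2)
    (fun _ _ => hB0 _ _ _) (a := (n, m, j)) ?_
  have := abs_le.1 hm
  simp only [Finset.mem_product, Finset.mem_range, Finset.mem_Icc]
  omega

/-- With `x = 1 / r` this absorbs the intermediate powers from the Leibniz rule into the two extreme
ones. -/
theorem pow_le_one_add_pow {x : ℝ} (hx : 0 ≤ x) {j N : ℕ} (hj : j ≤ N) : x ^ j ≤ 1 + x ^ N := by
  rcases le_total x 1 with h | h
  · exact (pow_le_one₀ hx h).trans (le_add_of_nonneg_right (by positivity))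
  · exact (pow_le_pow_right₀ h hj).trans (le_add_of_nonneg_left zero_le_one)

/-- Leibniz bound for a density times the kernel along a line of the element. -/
theorem norm_iteratedDerivWithin_mul_multipoleKernel_le {h r B A : ℝ} (hh : 0 < h) (hr : 0 < r)
    (hB : 0 ≤ B) {n : ℕ} {m : ℤ} {N : ℕ}
    (hK : ∀ j ≤ N, ∀ z ≠ 0,
      ‖iteratedFDeriv ℝ j (multipoleKernel n m) z‖ ≤ B / ‖z‖ ^ (n + 1 + j))
    {u : ℝ → ℂ} (hu : ContDiffOn ℝ N u (Icc 0 h))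
    (huA : ∀ j ≤ N, ∀ t ∈ Icc 0 h, ‖iteratedDerivWithin j u (Icc 0 h) t‖ ≤ A)
    (z v : E3) (hv : ‖v‖ ≤ 1) (hz : ∀ t ∈ Icc 0 h, r ≤ ‖z + t • v‖) :
    ∀ t ∈ Icc 0 h,
      ‖iteratedDerivWithin N (fun t => u t * multipoleKernel n m (z + t • v)) (Icc 0 h) t‖ ≤
        2 ^ N * A * B * (1 / r ^ (n + 1)) * (1 + (1 / r) ^ N) := by
  intro t ht
  have hI := uniqueDiffOn_Icc hh
  have hz0 : ∀ t ∈ Icc 0 h, z + t • v ∈ ({0}ᶜ : Set E3) := fun t ht => by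
    rw [mem_compl_singleton_iff, ← norm_pos_iff]
    exact hr.trans_le (hz t ht)
  have hA : 0 ≤ A := (norm_nonneg _).trans (huA 0 (Nat.zero_le _) t ht)
  have hopen : IsOpen ({0}ᶜ : Set E3) := isOpen_compl_singleton
  have hKs : ContDiffOn ℝ N (multipoleKernel n m) {0}ᶜ := fun z hz =>
    ((contDiffAt_multipoleKernel n m z hz).of_le (by exact_mod_cast le_top)).contDiffWithinAt
  have hL : ContDiffOn ℝ N (fun t : ℝ => multipoleKernel n m (z + t • v)) (Icc 0 h) :=
    hKs.comp (by fun_prop) hz0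
  have hder : ∀ j ≤ N,
      ‖iteratedDerivWithin j (fun t : ℝ => multipoleKernel n m (z + t • v)) (Icc 0 h) t‖ ≤
        B * (1 / r ^ (n + 1)) * (1 + (1 / r) ^ N) := by
    intro j hj
    rw [iteratedDerivWithin_comp_line hopen.uniqueDiffOn hI hKs z v hz0 j hj t ht,
      iteratedFDerivWithin_of_isOpen j hopen (hz0 t ht)]
    calc _ ≤ ‖iteratedFDeriv ℝ j (multipoleKernel n m) (z + t • v)‖ * ∏ _l : Fin j, ‖v‖ :=
          ContinuousMultilinearMap.le_opNorm _ _
      _ ≤ B / ‖z + t • v‖ ^ (n + 1 + j) * 1 := by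
          refine mul_le_mul (hK j hj _ (hz0 t ht)) (Finset.prod_le_one (fun _ _ => norm_nonneg _)
            fun _ _ => hv) (by positivity) (by positivity)
      _ ≤ B / r ^ (n + 1 + j) := by
          rw [mul_one]
          have := hz t ht
          gcongr
      _ = B * (1 / r ^ (n + 1)) * (1 / r) ^ j := by
          rw [pow_add, one_div_pow]
          field_simp
      _ ≤ _ := by
          gcongr
          exact pow_le_one_add_pow (by positivity) hj
  rw [← norm_iteratedFDerivWithin_eq_norm_iteratedDerivWithin]
  refine (norm_iteratedFDerivWithin_mul_le hu hL hI ht le_rfl).trans ?_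
  have hsum : ∑ i ∈ Finset.range (N + 1), (N.choose i : ℝ) = 2 ^ N := by
    exact_mod_cast Nat.sum_range_choose N
  calc _ ≤ ∑ i ∈ Finset.range (N + 1), (N.choose i : ℝ) *
        (A * (B * (1 / r ^ (n + 1)) * (1 + (1 / r) ^ N))) := by
        refine Finset.sum_le_sum fun i hi => ?_
        have hi : i ≤ N := by have := Finset.mem_range.1 hi; omega
        rw [mul_assoc, norm_iteratedFDerivWithin_eq_norm_iteratedDerivWithin,
          norm_iteratedFDerivWithin_eq_norm_iteratedDerivWithin]
        refine mul_le_mul_of_nonneg_left ?_ (Nat.cast_nonneg _)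
        exact mul_le_mul (huA i hi t ht) (hder _ (by omega)) (norm_nonneg _) hA
    _ = _ := by
        rw [← Finset.sum_mul, hsum]
        ring

/-! ### Surface measure and parametrization of the element. -/

theorem isometry_planeEmbedding :
    Isometry fun v : EuclideanSpace ℝ (Fin 2) => (!₂[v 0, v 1, 0] : E3) := by
  refine Isometry.of_dist_eq fun v w => ?_
  simp [EuclideanSpace.dist_eq, Fin.sum_univ_three]

/-- The normalized Hausdorff measure is Lebesgue measure on the Euclidean plane and is carried by
isometric embeddings to its restriction to their range, which contains the element. -/
theorem setIntegral_element (h : ℝ) (F : E3 → ℂ) :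
    ∫ s in element h, F s ∂(Measure.euclideanHausdorffMeasure 2) =
      ∫ x in square h, F !₂[x.1, x.2, 0] := by
  set ι := fun v : EuclideanSpace ℝ (Fin 2) => (!₂[v 0, v 1, 0] : E3) with hι
  have hiso : Isometry ι := isometry_planeEmbedding
  have hsub : element h ⊆ range ι := by
    rintro x ⟨-, -, hx⟩
    refine ⟨!₂[x 0, x 1], ?_⟩
    ext i
    fin_cases i <;> simp [hι, hx]
  have hmap := hiso.map_euclideanHausdorffMeasure (d := 2)
  rw [EuclideanSpace.euclideanHausdorffMeasure_eq_volume] at hmap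
  have e1 : (Measure.euclideanHausdorffMeasure 2 : Measure E3).restrict (element h) =
      (Measure.map ι volume).restrict (element h) := by
    rw [hmap, Measure.restrict_restrict_of_subset hsub]
  have hι' := hiso.isClosedEmbedding.measurableEmbedding
  rw [e1, hι'.setIntegral_map]
  have hp : MeasurePreserving
      (fun v : EuclideanSpace ℝ (Fin 2) => MeasurableEquiv.finTwoArrow (WithLp.ofLp v))
      volume volume :=
    (volume_preserving_finTwoArrow ℝ).comp (PiLp.volume_preserving_ofLp (Fin 2))
  have hpe : MeasurableEmbedding
      (fun v : EuclideanSpace ℝ (Fin 2) => MeasurableEquiv.finTwoArrow (WithLp.ofLp v)) :=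
    (MeasurableEquiv.finTwoArrow (α := ℝ)).measurableEmbedding.comp
      (MeasurableEquiv.toLp 2 (Fin 2 → ℝ)).symm.measurableEmbedding
  rw [← hp.setIntegral_preimage_emb hpe]
  have : ι ⁻¹' element h =
      (fun v : EuclideanSpace ℝ (Fin 2) => MeasurableEquiv.finTwoArrow (WithLp.ofLp v)) ⁻¹'
        square h := by
    ext v
    simp only [hι, element, square, mem_preimage, mem_prod]
    simp [and_assoc]
  rw [this]
  rfl

theorem elementMap_eq (h : ℝ) (x : ℝ × ℝ) :
    elementMap h x = !₂[h / 2 * (x.1 + 1), h / 2 * (x.2 + 1), 0] := by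
  ext i
  fin_cases i <;> simp [elementMap]

theorem areaElement_elementMap (h : ℝ) (x : ℝ × ℝ) :
    areaElement (elementMap h) x = (h / 2) ^ 2 := by
  set A : ℝ × ℝ →L[ℝ] E3 :=
    (ContinuousLinearMap.fst ℝ ℝ ℝ).smulRight (!₂[h / 2, 0, 0] : E3) +
      (ContinuousLinearMap.snd ℝ ℝ ℝ).smulRight (!₂[0, h / 2, 0] : E3) with hA
  have hfun : elementMap h = fun x => A x + !₂[h / 2, h / 2, 0] := by
    funext x
    rw [elementMap_eq]
    ext i
    fin_cases i <;> simp [hA] <;> ring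
  have hd : fderiv ℝ (elementMap h) x = A := by
    rw [hfun, fderiv_add_const]
    exact A.fderiv
  rw [areaElement, hd]
  simp [hA, crossProduct, EuclideanSpace.norm_eq, Fin.sum_univ_three]
  rw [Real.sqrt_sq (mul_self_nonneg _), sq]

theorem coeffIntegrand_eq (μ : E3 → ℂ) (c : E3) (n : ℕ) (m : ℤ) (a b : ℝ) :
    coeffIntegrand μ c n m !₂[a, b, 0] =
      onSquare μ (a, b) * multipoleKernel n (-m) (!₂[a, b, 0] - c) := by
  rw [coeffIntegrand, multipoleKernel, onSquare]
  ring

theorem tensorQuadrature_eq {q : ℕ} (y w : Fin q → ℝ) (h : ℝ) (F : E3 → ℂ) :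
    tensorQuadrature y w (elementMap h) F = ∑ i, ∑ j, (w i : ℂ) * (w j : ℂ) *
      F !₂[h / 2 * (y i + 1), h / 2 * (y j + 1), 0] * (((h / 2) ^ 2 : ℝ) : ℂ) := by
  simp only [tensorQuadrature, areaElement_elementMap, elementMap_eq]

end QBX

/-! ### Assembly of the estimate. -/

open QBX in
theorem mainTheorem10 (p q : ℕ) (hq : 1 ≤ q) :
    ∃ C : ℝ, 0 < C ∧
      ∀ y w : Fin q → ℝ, QBX.IsGaussLegendre q y w →
      ∀ (h r : ℝ), 0 < h → 0 < r →
      ∀ c : QBX.E3, Metric.infDist c (QBX.element h) = r →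
      ∀ (n : ℕ) (m : ℤ), n ≤ p → |m| ≤ (n : ℤ) →
      ∀ μ : QBX.E3 → ℂ, QBX.IsCk (2 * q) h μ →
        ‖QBX.tensorQuadrature y w (QBX.elementMap h) (QBX.coeffIntegrand μ c n m) -
            ∫ s in QBX.element h, QBX.coeffIntegrand μ c n m s
              ∂(MeasureTheory.Measure.euclideanHausdorffMeasure 2)‖ ≤
          C * (1 + h) * (h / 4) ^ (2 * q + 1) * (1 / r ^ (n + 1)) *
            (1 + (1 / r) ^ (2 * q)) * QBX.ckNorm (2 * q) h μ := by
  obtain ⟨B, hB0, hB⟩ := exists_norm_iteratedFDeriv_multipoleKernel_le p (2 * q)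
  -- The factors come from the tensor error, the Leibniz binomials, the kernel bound (`B + 1`
  -- because `B` may be `0`), and the rescaling of `h` to `h / 4`.
  refine ⟨4 * 2 ^ (2 * q) * (B + 1) * 4 ^ (2 * q + 1), by positivity, ?_⟩
  intro y w H h r hh hr c hc n m hn hm μ hμ
  have hμ' : ContDiffOn ℝ (2 * q : ℕ) (onSquare μ) (square h) := by
    exact_mod_cast hμ
  have hK : ∀ j ≤ 2 * q, ∀ z ≠ 0, ‖iteratedFDeriv ℝ j (multipoleKernel n (-m)) z‖ ≤
      (B + 1) / ‖z‖ ^ (n + 1 + j) := fun j hj z hz =>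
    (hB n (-m) hn (by rwa [abs_neg]) j hj z hz).trans (by gcongr; linarith)
  have hdist : ∀ x ∈ square h, r ≤ ‖(!₂[x.1, x.2, 0] : E3) - c‖ := by
    intro x hx
    rw [← dist_eq_norm, dist_comm, ← hc]
    exact Metric.infDist_le_dist_of_mem ⟨by simpa using hx.1, by simpa using hx.2, by simp⟩
  have hck0 : 0 ≤ ckNorm (2 * q) h μ :=
    (norm_nonneg _).trans (norm_partial_le_ckNorm hh hμ' (Nat.zero_le _) 0
      (x := (0, 0)) ⟨⟨le_rfl, hh.le⟩, ⟨le_rfl, hh.le⟩⟩)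
  have hI := uniqueDiffOn_Icc hh
  have hS := uniqueDiffOn_square hh
  set M := 2 ^ (2 * q) * ckNorm (2 * q) h μ * (B + 1) * (1 / r ^ (n + 1)) *
    (1 + (1 / r) ^ (2 * q)) with hM
  have key := H.norm_tensor_error_le hq hh (M := M)
    (F := fun x => onSquare μ x * multipoleKernel n (-m) (!₂[x.1, x.2, 0] - c))
    (by
      refine hμ'.mul ?_
      intro x hx
      have h0 : (!₂[x.1, x.2, 0] : E3) - c ≠ 0 := norm_pos_iff.1 (hr.trans_le (hdist x hx))
      have h1 := (contDiffAt_multipoleKernel n (-m) _ h0).of_le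
        (m := (2 * q : ℕ)) (by generalize 2 * q = N; exact_mod_cast le_top)
      have h2 : ContDiffAt ℝ (2 * q : ℕ) (fun x : ℝ × ℝ => (!₂[x.1, x.2, 0] : E3) - c) x := by
        refine ContDiffAt.sub ?_ contDiffAt_const
        rw [contDiffAt_euclidean]
        intro i
        fin_cases i <;> simp <;> fun_prop
      exact (h1.comp x h2).contDiffWithinAt)
    (by
      intro t ht s hs
      have hline : ∀ t : ℝ, ((0, s) : ℝ × ℝ) + t • basisVec 0 = (t, s) := fun t => by
        simp [basisVec]
      have hu := iteratedDerivWithin_comp_line hS hI hμ' (0, s) (basisVec 0)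
        (fun t ht => by rw [hline]; exact ⟨ht, hs⟩)
      simp only [hline] at hu
      have hz : ∀ t : ℝ, ((!₂[0, s, 0] : E3) - c) + t • (!₂[1, 0, 0] : E3) = !₂[t, s, 0] - c :=
        fun t => by ext i; fin_cases i <;> simp <;> ring
      have := norm_iteratedDerivWithin_mul_multipoleKernel_le hh hr (by positivity) hK
        (u := fun t => onSquare μ (t, s)) (A := ckNorm (2 * q) h μ)
        (hμ'.comp (t := square h) (by fun_prop) fun t ht => ⟨ht, hs⟩)
        (fun j hj t ht => by
          rw [hu j hj t ht]
          exact norm_partial_le_ckNorm hh hμ' hj 0 ⟨ht, hs⟩)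
        (!₂[0, s, 0] - c) !₂[1, 0, 0] (by simp [EuclideanSpace.norm_eq, Fin.sum_univ_three])
        (fun t ht => by rw [hz]; exact hdist (t, s) ⟨ht, hs⟩) t ht
      simpa only [hz] using this)
    (by
      intro t ht s hs
      have hline : ∀ s : ℝ, ((t, 0) : ℝ × ℝ) + s • basisVec 1 = (t, s) := fun s => by
        simp [basisVec]
      have hu := iteratedDerivWithin_comp_line hS hI hμ' (t, 0) (basisVec 1)
        (fun s hs => by rw [hline]; exact ⟨ht, hs⟩)
      simp only [hline] at hu
      have hz : ∀ s : ℝ, ((!₂[t, 0, 0] : E3) - c) + s • (!₂[0, 1, 0] : E3) = !₂[t, s, 0] - c :=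
        fun s => by ext i; fin_cases i <;> simp <;> ring
      have := norm_iteratedDerivWithin_mul_multipoleKernel_le hh hr (by positivity) hK
        (u := fun s => onSquare μ (t, s)) (A := ckNorm (2 * q) h μ)
        (hμ'.comp (t := square h) (by fun_prop) fun s hs => ⟨ht, hs⟩)
        (fun j hj s hs => by
          rw [hu j hj s hs]
          exact norm_partial_le_ckNorm hh hμ' hj 1 ⟨ht, hs⟩)
        (!₂[t, 0, 0] - c) !₂[0, 1, 0] (by simp [EuclideanSpace.norm_eq, Fin.sum_univ_three])
        (fun s hs => by rw [hz]; exact hdist (t, s) ⟨ht, hs⟩) s hs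
      simpa only [hz] using this)
  rw [tensorQuadrature_eq, setIntegral_element]
  simp only [coeffIntegrand_eq, Prod.mk.eta]
  refine key.trans ?_
  -- The tensor error has one more power of `h` than the claim; `h ≤ 1 + h` absorbs it.
  have h4 : h ^ (2 * q + 2) ≤ 4 ^ (2 * q + 1) * (1 + h) * (h / 4) ^ (2 * q + 1) := by
    have : 4 ^ (2 * q + 1) * (1 + h) * (h / 4) ^ (2 * q + 1) = h ^ (2 * q + 1) * (1 + h) := by
      rw [div_pow]
      field_simp
    rw [this, pow_succ h (2 * q + 1)]
    gcongr
    linarith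
  have hM0 : 0 ≤ M := by positivity
  calc 4 * M * h ^ (2 * q + 2) ≤
      4 * M * (4 ^ (2 * q + 1) * (1 + h) * (h / 4) ^ (2 * q + 1)) := by gcongr
    _ = _ := by rw [hM]; ring
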